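/- Let $\mu,\tau>0$, and let $\{\alpha_k\}_{k\ge1}$ and $\{\delta_k\}_{k\ge1}$ be sequences of real random variables on a common probability space such that all the variables $\alpha_1,\delta_1,\alpha_2,\delta_2,\dots$ are mutually independent, each $\alpha_k$ is exponentially distributed with rate $\mu$ (mean $1/\mu$), and each $\delta_k$ is exponentially distributed with rate $\tau$ (mean $1/\tau$). Consider the system $\boldsymbol z(k)=A(k)\boldsymbol z(k-1)$, $k\ge 1$, where $$ A(k)=\begin{pmatrix}\alpha_k & 0\\ 0 & \delta_k\end{pmatrix},\qquad \boldsymbol z(k)=\begin{pmatrix}x(k)\\ y(k)\end{pmatrix},\qquad \boldsymbol z(0)=\begin{pmatrix}0\\ 0\end{pmatrix}, $$ and the matrix-vector product is taken in the max-plus semiring (maximum as addition, ordinary addition as multiplication; the entries $0$ are the real number $0$); that is, $$ x(k)=\max(x(k-1)+\alpha_k,\;y(k-1)),\qquad y(k)=\max(x(k-1),\;y(k-1)+\delta_k). $$ Then the Lyapunov exponent $\lambda=\lim_{k\to\infty}\frac1k\max(x(k),y(k))$ exists almost surely and almost surely equals the constant $$ \lambda=\frac{\mu^{4}+\mu^{3}\tau+\mu^{2}\tau^{2}+\mu\tau^{3}+\tau^{4}}{\mu\tau(\mu+\tau)(\mu^{2}+\tau^{2})}.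 $$ In particular, for $\mu=\tau=1$ one has $\lambda=1.25$. -/

import Mathlib

/-!
Only the difference of the coordinates matters for the growth of their maximum, and exponential
variables have no memory: when `x` leads by `d`, the step puts `y` at height `(δ - d)⁺` above the
old `x`, which is either `0` or a fresh exponential variable. Hence subtracting a suitable bounded
function of `x - y` from `max x y` yields an observable whose mean increment is the same constant in
every state. The coefficients of the correction and that constant solve the linear system given by
the means of the observable in the states `(α, 0)`, `(0, δ)` and `(α, δ)`.

The observable minus its drift has orthogonal increments with bounded second moments, so its second
moment grows linearly and, by summability of `1 / n ^ 2`, it is almost surely `o(n)` along the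
squares. The maximum itself differs from the observable by a bounded amount and is nondecreasing in
time, which fills the gaps between consecutive squares.
-/

open MeasureTheory ProbabilityTheory Filter Topology

namespace MaxPlus

noncomputable section

/-- Product of a `2 × 2` matrix and a vector in the semiring with maximum as addition and `+` as
multiplication. -/
def mulVec (A : Matrix (Fin 2) (Fin 2) ℝ) (z : Fin 2 → ℝ) : Fin 2 → ℝ :=
  fun i => max (z 0 + A i 0) (z 1 + A i 1)

/-- State vectors of `z(k) = A(k) z(k-1)`, `z(0) = (0, 0)`.  The term `A k` of the sequence is the
transition matrix of step `k + 1`, i.e. the transition matrices are numbered from `0`. -/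
def state (A : ℕ → Matrix (Fin 2) (Fin 2) ℝ) : ℕ → Fin 2 → ℝ
  | 0 => fun _ => 0
  | k + 1 => mulVec (A k) (state A k)

/-- `l` is the Lyapunov exponent of the stochastic system with random transition matrices `A k`:
almost surely, `max (x(k), y(k)) / k` converges to `l`. -/
def IsLyapunovExponent {Ω : Type*} [MeasurableSpace Ω] (P : Measure Ω)
    (A : ℕ → Ω → Matrix (Fin 2) (Fin 2) ℝ) (l : ℝ) : Prop :=
  ∀ᵐ ω ∂P, Tendsto
    (fun k : ℕ => 1 / (k : ℝ) *
      max (state (fun n => A n ω) k 0) (state (fun n => A n ω) k 1))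
    atTop (𝓝 l)

end

end MaxPlus

namespace MaxPlus

section LawOfLargeNumbers

variable {Ω : Type*} [MeasurableSpace Ω] {P : Measure Ω}

lemma ae_tendsto_div_sq_of_integral_sq_le {M : ℕ → Ω → ℝ} (hM : ∀ n, MemLp (M n) 2 P) {C : ℝ}
    (hC : ∀ n, ∫ ω, M n ω ^ 2 ∂P ≤ C * n) :
    ∀ᵐ ω ∂P, Tendsto (fun n : ℕ => M (n ^ 2) ω / (n : ℝ) ^ 2) atTop (𝓝 0) := by
  have hsq : ∀ n : ℕ, Integrable (fun ω => (M (n ^ 2) ω / (n : ℝ) ^ 2) ^ 2) P := fun n => by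
    simp_rw [div_pow]
    exact (hM _).integrable_sq.div_const _
  have hbound : ∀ n : ℕ, ∫ ω, ‖(M (n ^ 2) ω / (n : ℝ) ^ 2) ^ 2‖ ∂P ≤ C * (1 / (n : ℝ) ^ 2) := by
    intro n
    simp_rw [norm_pow, Real.norm_eq_abs, sq_abs, div_pow]
    rw [integral_div]
    rcases n.eq_zero_or_pos with rfl | hn
    · simp
    · calc (∫ ω, M (n ^ 2) ω ^ 2 ∂P) / ((n : ℝ) ^ 2) ^ 2
          ≤ C * (n ^ 2 : ℕ) / ((n : ℝ) ^ 2) ^ 2 := by gcongr; exact hC _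
        _ = C * (1 / (n : ℝ) ^ 2) := by push_cast; field_simp
  have hsum : Summable fun n : ℕ => ∫ ω, ‖(M (n ^ 2) ω / (n : ℝ) ^ 2) ^ 2‖ ∂P :=
    .of_nonneg_of_le (fun n => integral_nonneg fun ω => norm_nonneg _) hbound
      ((Real.summable_one_div_nat_pow.2 one_lt_two).mul_left C)
  have hsum' : ∑' n : ℕ, eLpNorm (fun ω => (M (n ^ 2) ω / (n : ℝ) ^ 2) ^ 2) 1 P ≠ ⊤ := by
    simp_rw [eLpNorm_one_eq_lintegral_enorm, ← ofReal_integral_norm_eq_lintegral_enorm (hsq _)]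
    exact hsum.tsum_ofReal_ne_top
  filter_upwards [summable_norm_of_tsum_eLpNorm_ne_top le_rfl
    (fun n => (hsq n).aestronglyMeasurable) hsum'] with ω hω
  have h := tendsto_zero_iff_norm_tendsto_zero.2 hω.tendsto_atTop_zero
  simpa [Real.sqrt_sq_eq_abs, tendsto_zero_iff_abs_tendsto_zero, Function.comp_def] using h.sqrt

lemma tendsto_div_of_monotone_of_tendsto_div_sq {u : ℕ → ℝ} {l : ℝ} (hu : Monotone u)
    (h : Tendsto (fun n : ℕ => u (n ^ 2) / (n : ℝ) ^ 2) atTop (𝓝 l)) :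
    Tendsto (fun n : ℕ => u n / n) atTop (𝓝 l) := by
  refine tendsto_div_of_monotone_of_exists_subseq_tendsto_div u l hu fun a ha =>
    ⟨fun n => n ^ 2, ?_, tendsto_pow_atTop two_ne_zero, by simpa using h⟩
  filter_upwards [eventually_ge_atTop 1, eventually_ge_atTop ⌈3 / (a - 1)⌉₊] with n h_one h_ceil
  have hn : (1 : ℝ) ≤ n := by exact_mod_cast h_one
  have hna : 3 ≤ (n : ℝ) * (a - 1) := (div_le_iff₀ (sub_pos.2 ha)).1 (Nat.ceil_le.1 h_ceil)
  push_cast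
  nlinarith

variable {M : ℕ → Ω → ℝ}

lemma memLp_of_memLp_increments {p : ENNReal} (h_zero : MemLp (M 0) p P)
    (hinc : ∀ n, MemLp (fun ω => M (n + 1) ω - M n ω) p P) (n : ℕ) : MemLp (M n) p P := by
  induction n with
  | zero => exact h_zero
  | succ n ih => exact (ih.add (hinc n)).ae_eq (ae_of_all _ fun ω => add_sub_cancel _ _)

lemma integral_sq_le_of_orthogonal_increments (h_zero : M 0 = 0)
    (hinc : ∀ n, MemLp (fun ω => M (n + 1) ω - M n ω) 2 P)
    (horth : ∀ n, ∫ ω, M n ω * (M (n + 1) ω - M n ω) ∂P = 0) {C : ℝ}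
    (hC : ∀ n, ∫ ω, (M (n + 1) ω - M n ω) ^ 2 ∂P ≤ C) (n : ℕ) :
    ∫ ω, M n ω ^ 2 ∂P ≤ C * n := by
  have hM := memLp_of_memLp_increments (h_zero ▸ MemLp.zero) hinc
  induction n with
  | zero => simp [h_zero]
  | succ n ih =>
    have hcross : Integrable (fun ω => M n ω * (M (n + 1) ω - M n ω)) P :=
      (hM n).integrable_mul (hinc n)
    calc ∫ ω, M (n + 1) ω ^ 2 ∂P
        = ∫ ω, (M n ω ^ 2 + 2 * (M n ω * (M (n + 1) ω - M n ω))
            + (M (n + 1) ω - M n ω) ^ 2) ∂P := by congr with ω; ring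
      _ = ∫ ω, M n ω ^ 2 ∂P + ∫ ω, (M (n + 1) ω - M n ω) ^ 2 ∂P := by
        rw [integral_add ((hM n).integrable_sq.fun_add (hcross.const_mul 2))
          (hinc n).integrable_sq, integral_add (hM n).integrable_sq (hcross.const_mul 2),
          integral_const_mul, horth, mul_zero, add_zero]
      _ ≤ C * n + C := add_le_add ih (hC n)
      _ = C * (n + 1 : ℕ) := by push_cast; ring

end LawOfLargeNumbers

section DrivenSystem

variable {Ω E F : Type*} [MeasurableSpace Ω] [MeasurableSpace E] [MeasurableSpace F]
  {P : Measure Ω} {ρ : Measure F} {φ : E → F → E} {z₀ : E} {W : ℕ → Ω → F}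

/-- The orbit of `z₀` under the recursion `z (n + 1) = φ (z n) (w n)` driven by the inputs `w`. -/
def orbit {E F : Type*} (φ : E → F → E) (z₀ : E) (w : ℕ → F) : ℕ → E
  | 0 => z₀
  | n + 1 => φ (orbit φ z₀ w n) (w n)

lemma exists_measurable_orbit_eq (hφ : Measurable fun p : E × F => φ p.1 p.2) (z₀ : E) (n : ℕ) :
    ∃ G : (Fin n → F) → E, Measurable G ∧ ∀ w : ℕ → F, orbit φ z₀ w n = G fun k => w k := by
  induction n with
  | zero => exact ⟨fun _ => z₀, measurable_const, fun _ => rfl⟩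
  | succ n ih =>
    obtain ⟨G, hG, hG_eq⟩ := ih
    refine ⟨fun t => φ (G fun k => t k.castSucc) (t (Fin.last n)), ?_, fun w => ?_⟩
    · exact hφ.comp ((hG.comp (by fun_prop)).prodMk (measurable_pi_apply _))
    · simp [orbit, hG_eq]

lemma aemeasurable_orbit (hφ : Measurable fun p : E × F => φ p.1 p.2)
    (hW : ∀ n, AEMeasurable (W n) P) (n : ℕ) :
    AEMeasurable (fun ω => orbit φ z₀ (W · ω) n) P := by
  obtain ⟨G, hG, hG_eq⟩ := exists_measurable_orbit_eq hφ z₀ n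
  simp_rw [hG_eq]
  exact hG.comp_aemeasurable (aemeasurable_pi_lambda _ fun k => hW k)

lemma indepFun_orbit (hφ : Measurable fun p : E × F => φ p.1 p.2) {n : ℕ}
    (hpast : IndepFun (fun ω (k : Fin n) => W k ω) (W n) P) :
    IndepFun (fun ω => orbit φ z₀ (W · ω) n) (W n) P := by
  obtain ⟨G, hG, hG_eq⟩ := exists_measurable_orbit_eq hφ z₀ n
  simp_rw [hG_eq]
  exact hpast.comp hG measurable_id

lemma integral_mul_eq_zero_of_indepFun [IsFiniteMeasure P] {X : Ω → E} {Y : Ω → F}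
    (hX : AEMeasurable X P) (hY : HasLaw Y ρ P) (hXY : IndepFun X Y P)
    {f : E → ℝ} {g : E → F → ℝ} (hf : Measurable f) (hg : Measurable fun p : E × F => g p.1 p.2)
    (hint : Integrable (fun ω => f (X ω) * g (X ω) (Y ω)) P) (hzero : ∀ x, ∫ y, g x y ∂ρ = 0) :
    ∫ ω, f (X ω) * g (X ω) (Y ω) ∂P = 0 := by
  have := hY.isFiniteMeasure_iff.1 ‹_›
  have hpair : HasLaw (fun ω => (X ω, Y ω)) ((P.map X).prod ρ) P :=
    IndepFun.hasLaw_prod ⟨hX, rfl⟩ hY hXY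
  have hm : Measurable fun p : E × F => f p.1 * g p.1 p.2 := (hf.comp measurable_fst).mul hg
  have hint' : Integrable (fun p : E × F => f p.1 * g p.1 p.2) ((P.map X).prod ρ) := by
    rwa [← hpair.map_eq, integrable_map_measure hm.aestronglyMeasurable hpair.aemeasurable]
  calc ∫ ω, f (X ω) * g (X ω) (Y ω) ∂P = ∫ p, f p.1 * g p.1 p.2 ∂(P.map X).prod ρ :=
        hpair.integral_comp hm.aestronglyMeasurable
    _ = ∫ x, f x * ∫ y, g x y ∂ρ ∂P.map X := by
        rw [integral_prod _ hint']
        simp only [integral_const_mul]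
    _ = 0 := by simp only [hzero, mul_zero, integral_zero]

lemma ae_tendsto_div_sq_of_centred_increments [IsFiniteMeasure P] {Z : ℕ → Ω → E}
    (hZ : ∀ n, AEMeasurable (Z n) P) (hW : ∀ n, HasLaw (W n) ρ P)
    (hZW : ∀ n, IndepFun (Z n) (W n) P) {g : E → F → ℝ}
    (hg : Measurable fun p : E × F => g p.1 p.2) {b : F → ℝ} (hb : MemLp b 2 ρ)
    (hg_le : ∀ z w, |g z w| ≤ b w) (hg_zero : ∀ z, ∫ w, g z w ∂ρ = 0) {f : ℕ → E → ℝ}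
    (hf : ∀ n, Measurable (f n)) (h_zero : ∀ ω, f 0 (Z 0 ω) = 0)
    (hinc : ∀ n ω, f (n + 1) (Z (n + 1) ω) - f n (Z n ω) = g (Z n ω) (W n ω)) :
    ∀ᵐ ω ∂P, Tendsto (fun n : ℕ => f (n ^ 2) (Z (n ^ 2) ω) / (n : ℝ) ^ 2) atTop (𝓝 0) := by
  have hbW : ∀ n, MemLp (fun ω => b (W n ω)) 2 P := fun n =>
    MemLp.comp_of_map ((hW n).map_eq.symm ▸ hb) (hW n).aemeasurable
  have hinc_memLp : ∀ n, MemLp (fun ω => g (Z n ω) (W n ω)) 2 P := fun n =>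
    (hbW n).mono' (hg.comp_aemeasurable ((hZ n).prodMk (hW n).aemeasurable)).aestronglyMeasurable
      (ae_of_all _ fun ω => hg_le _ _)
  have hinc_sq : ∀ n, ∫ ω, g (Z n ω) (W n ω) ^ 2 ∂P ≤ ∫ w, b w ^ 2 ∂ρ := fun n => by
    calc ∫ ω, g (Z n ω) (W n ω) ^ 2 ∂P ≤ ∫ ω, b (W n ω) ^ 2 ∂P :=
          integral_mono (hinc_memLp n).integrable_sq (hbW n).integrable_sq fun ω =>
            sq_le_sq' (neg_le_of_abs_le (hg_le _ _)) (le_of_abs_le (hg_le _ _))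
      _ = ∫ w, b w ^ 2 ∂ρ := (hW n).integral_comp hb.integrable_sq.aestronglyMeasurable
  have hf_memLp := memLp_of_memLp_increments (M := fun n ω => f n (Z n ω)) (p := 2) (P := P)
    (by simp only [h_zero]; exact MemLp.zero) (by simpa only [hinc] using hinc_memLp)
  have horth : ∀ n, ∫ ω, f n (Z n ω) * g (Z n ω) (W n ω) ∂P = 0 := fun n =>
    integral_mul_eq_zero_of_indepFun (hZ n) (hW n) (hZW n) (hf n) hg
      ((hf_memLp n).integrable_mul (hinc_memLp n)) hg_zero
  exact ae_tendsto_div_sq_of_integral_sq_le hf_memLp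
    (integral_sq_le_of_orthogonal_increments (C := ∫ w, b w ^ 2 ∂ρ) (funext h_zero)
      (by simpa only [hinc]) (by simpa only [hinc]) (by simpa only [hinc]))

lemma ae_tendsto_div_sq_of_drift [IsProbabilityMeasure P]
    (hφ : Measurable fun p : E × F => φ p.1 p.2) (hW : ∀ n, HasLaw (W n) ρ P)
    (hpast : ∀ n, IndepFun (fun ω (k : Fin n) => W k ω) (W n) P)
    {h : E → ℝ} (hh : Measurable h) {b : F → ℝ} (hb : MemLp b 2 ρ)
    (hbound : ∀ z w, |h (φ z w) - h z| ≤ b w) {l : ℝ}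
    (hdrift : ∀ z, ∫ w, (h (φ z w) - h z) ∂ρ = l) :
    ∀ᵐ ω ∂P, Tendsto (fun n : ℕ => h (orbit φ z₀ (W · ω) (n ^ 2)) / (n : ℝ) ^ 2) atTop (𝓝 l) := by
  have := (hW 0).isProbabilityMeasure_iff.1 ‹_›
  have hg : Measurable fun p : E × F => h (φ p.1 p.2) - h p.1 - l :=
    ((hh.comp hφ).sub (hh.comp measurable_fst)).sub_const l
  have hg_zero : ∀ z, ∫ w, (h (φ z w) - h z - l) ∂ρ = 0 := by
    intro z
    have hi : Integrable (fun w => h (φ z w) - h z) ρ :=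
      (hb.integrable one_le_two).mono'
        (((hh.comp hφ).comp measurable_prodMk_left).sub_const _).aestronglyMeasurable
        (ae_of_all _ (hbound z))
    rw [integral_sub hi (integrable_const l), hdrift, integral_const, probReal_univ, one_smul,
      sub_self]
  filter_upwards [ae_tendsto_div_sq_of_centred_increments (f := fun n z => h z - h z₀ - l * n)
    (aemeasurable_orbit (z₀ := z₀) hφ fun n => (hW n).aemeasurable) hW
    (fun n => indepFun_orbit hφ (hpast n)) hg (hb.add (memLp_const |l|))
    (fun z w => (abs_sub _ _).trans (add_le_add_left (hbound z w) _)) hg_zero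
    (fun n => (hh.sub_const _).sub_const _) (fun ω => by simp [orbit])
    (fun n ω => by simp only [orbit]; push_cast; ring)] with ω hω
  have hconst : Tendsto (fun n : ℕ => h z₀ / (n : ℝ) ^ 2 + l) atTop (𝓝 (0 + l)) :=
    ((tendsto_const_nhds (x := h z₀)).div_atTop
      ((tendsto_pow_atTop two_ne_zero).comp tendsto_natCast_atTop_atTop)).add_const l
  have hsum := hω.add hconst
  rw [zero_add, zero_add] at hsum
  refine hsum.congr' ?_
  filter_upwards [eventually_ne_atTop 0] with n hn
  push_cast
  field_simp
  ring

theorem ae_tendsto_div_of_drift [IsProbabilityMeasure P]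
    (hφ : Measurable fun p : E × F => φ p.1 p.2) (hW : ∀ n, HasLaw (W n) ρ P)
    (hpast : ∀ n, IndepFun (fun ω (k : Fin n) => W k ω) (W n) P)
    {h : E → ℝ} (hh : Measurable h) {b : F → ℝ} (hb : MemLp b 2 ρ)
    (hbound : ∀ z w, |h (φ z w) - h z| ≤ b w) {l : ℝ}
    (hdrift : ∀ z, ∫ w, (h (φ z w) - h z) ∂ρ = l) {u : E → ℝ} {K : ℝ}
    (hu : ∀ z, |h z - u z| ≤ K)
    (hmono : ∀ᵐ ω ∂P, Monotone fun n => u (orbit φ z₀ (W · ω) n)) :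
    ∀ᵐ ω ∂P, Tendsto (fun n : ℕ => u (orbit φ z₀ (W · ω) n) / n) atTop (𝓝 l) := by
  filter_upwards [ae_tendsto_div_sq_of_drift (z₀ := z₀) hφ hW hpast hh hb hbound hdrift, hmono]
    with ω hω hω_mono
  refine tendsto_div_of_monotone_of_tendsto_div_sq hω_mono ?_
  have hsq : Tendsto (fun n : ℕ => (n : ℝ) ^ 2) atTop atTop :=
    (tendsto_pow_atTop two_ne_zero).comp tendsto_natCast_atTop_atTop
  have hdiff : Tendsto (fun n : ℕ => (h (orbit φ z₀ (W · ω) (n ^ 2))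
      - u (orbit φ z₀ (W · ω) (n ^ 2))) / (n : ℝ) ^ 2) atTop (𝓝 0) :=
    squeeze_zero_norm (fun n => by
      rw [norm_div, Real.norm_eq_abs, norm_pow, RCLike.norm_natCast]
      gcongr
      exact hu _) (tendsto_const_nhds.div_atTop hsq)
  simpa only [sub_zero, ← sub_div, sub_sub_cancel] using hω.sub hdiff

end DrivenSystem

section Exponential

variable {r μ τ : ℝ}

lemma expMeasure_eq_withDensity (r : ℝ) :
    expMeasure r = (volume.restrict (Set.Ioi 0)).withDensity
      (fun t => ENNReal.ofReal (r * Real.exp (-(r * t)))) := by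
  have h : exponentialPDF r = (Set.Ici (0 : ℝ)).indicator
      (fun t => ENNReal.ofReal (r * Real.exp (-(r * t)))) := by
    ext t
    by_cases ht : 0 ≤ t
    · rw [Set.indicator_of_mem (Set.mem_Ici.2 ht), exponentialPDF_of_nonneg ht]
    · rw [Set.indicator_of_notMem (by simpa using ht), exponentialPDF_of_neg (not_le.1 ht)]
  change volume.withDensity (exponentialPDF r) = _
  rw [h, withDensity_indicator measurableSet_Ici, Measure.restrict_congr_set Ioi_ae_eq_Ici]

lemma integral_expMeasure (hr : 0 ≤ r) (f : ℝ → ℝ) :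
    ∫ t, f t ∂expMeasure r = ∫ t in Set.Ioi 0, r * Real.exp (-(r * t)) * f t := by
  rw [expMeasure_eq_withDensity, integral_withDensity_eq_integral_toReal_smul (by fun_prop)
    (ae_of_all _ fun _ => ENNReal.ofReal_lt_top)]
  congr with t
  rw [ENNReal.toReal_ofReal (by positivity), smul_eq_mul]

lemma ae_expMeasure_pos (r : ℝ) : ∀ᵐ t ∂expMeasure r, 0 < t := by
  rw [expMeasure_eq_withDensity]
  exact (withDensity_absolutelyContinuous _ _).ae_le (ae_restrict_mem measurableSet_Ioi)

lemma ae_expMeasure_nonneg (r : ℝ) : ∀ᵐ t ∂expMeasure r, 0 ≤ t :=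
  (ae_expMeasure_pos r).mono fun _ => le_of_lt

lemma integral_exp_neg_mul_expMeasure {a : ℝ} (hr : 0 ≤ r) (hra : 0 < r + a) :
    ∫ t, Real.exp (-(a * t)) ∂expMeasure r = r / (r + a) := by
  calc ∫ t, Real.exp (-(a * t)) ∂expMeasure r
      = ∫ t in Set.Ioi (0 : ℝ), r * Real.exp (-(r + a) * t) := by
        rw [integral_expMeasure hr]
        congr with t
        rw [mul_assoc, ← Real.exp_add]
        ring_nf
    _ = r / (r + a) := by
        rw [integral_const_mul, integral_exp_mul_Ioi (by linarith), neg_mul, mul_zero, neg_zero,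
          Real.exp_zero, neg_div_neg_eq, mul_one_div]

lemma integral_id_expMeasure (hr : 0 < r) : ∫ t, t ∂expMeasure r = 1 / r := by
  calc ∫ t, t ∂expMeasure r
      = r * ∫ t in Set.Ioi (0 : ℝ), t ^ ((2 : ℝ) - 1) * Real.exp (-(r * t)) := by
        rw [integral_expMeasure hr.le, ← integral_const_mul]
        congr with t
        norm_num
        ring
    _ = 1 / r := by
        rw [Real.integral_rpow_mul_exp_neg_mul_Ioi two_pos hr, Real.Gamma_two]
        norm_num
        field_simp

lemma memLp_two_id_expMeasure (hr : 0 < r) : MemLp (fun t : ℝ => t) 2 (expMeasure r) := by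
  rw [memLp_two_iff_integrable_sq (by fun_prop), expMeasure_eq_withDensity,
    integrable_withDensity_iff_integrable_smul' (by fun_prop)
      (ae_of_all _ fun _ => ENNReal.ofReal_lt_top)]
  refine ((integrableOn_rpow_mul_exp_neg_mul_rpow (p := 1) (s := 2) (by norm_num)
    zero_lt_one hr).const_mul r).congr (ae_of_all _ fun t => ?_)
  simp only [smul_eq_mul]
  rw [ENNReal.toReal_ofReal (by positivity), Real.rpow_one, Real.rpow_two, neg_mul]
  ring

lemma measureReal_expMeasure_Iic {x : ℝ} (hr : 0 < r) (hx : 0 ≤ x) :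
    (expMeasure r).real (Set.Iic x) = 1 - Real.exp (-(r * x)) := by
  have := isProbabilityMeasure_expMeasure hr
  rw [← cdf_eq_real, cdf_expMeasure_eq hr, if_pos hx]

lemma exp_neg_mul_le_one {t : ℝ} (hr : 0 ≤ r) (ht : 0 ≤ t) : Real.exp (-(r * t)) ≤ 1 :=
  Real.exp_le_one_iff.2 (neg_nonpos.2 (mul_nonneg hr ht))

lemma integrable_exp_neg_mul {ν : Measure ℝ} [IsFiniteMeasure ν] (hr : 0 ≤ r)
    (hν : ∀ᵐ t ∂ν, 0 ≤ t) : Integrable (fun t => Real.exp (-(r * t))) ν :=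
  (integrable_const (1 : ℝ)).mono' (by fun_prop) (by
    filter_upwards [hν] with t ht
    rw [Real.norm_eq_abs, Real.abs_exp]
    exact exp_neg_mul_le_one hr ht)

/-- The mixture that takes the value `0` with probability `1 - p` and is distributed as `ρ` with
probability `p`. -/
noncomputable def zeroInflated (p : ℝ) (ρ : Measure ℝ) : Measure ℝ :=
  ENNReal.ofReal (1 - p) • Measure.dirac 0 + ENNReal.ofReal p • ρ

lemma isProbabilityMeasure_zeroInflated {p : ℝ} {ρ : Measure ℝ} [IsProbabilityMeasure ρ]
    (h0 : 0 ≤ p) (h1 : p ≤ 1) : IsProbabilityMeasure (zeroInflated p ρ) := by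
  constructor
  simp [zeroInflated, ← ENNReal.ofReal_add (sub_nonneg.2 h1) h0]

lemma integrable_zeroInflated {p : ℝ} {ρ : Measure ℝ} {f : ℝ → ℝ} (hf : Integrable f ρ) :
    Integrable f (zeroInflated p ρ) :=
  ((integrable_dirac ENNReal.coe_lt_top).smul_measure ENNReal.ofReal_ne_top).add_measure
    (hf.smul_measure ENNReal.ofReal_ne_top)

lemma integral_zeroInflated {p : ℝ} {ρ : Measure ℝ} {f : ℝ → ℝ} (h0 : 0 ≤ p) (h1 : p ≤ 1)
    (hf : Integrable f ρ) :
    ∫ t, f t ∂zeroInflated p ρ = (1 - p) * f 0 + p * ∫ t, f t ∂ρ := by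
  rw [zeroInflated, integral_add_measure
    ((integrable_dirac ENNReal.coe_lt_top).smul_measure ENNReal.ofReal_ne_top)
    (hf.smul_measure ENNReal.ofReal_ne_top), integral_smul_measure, integral_smul_measure,
    integral_dirac, ENNReal.toReal_ofReal (sub_nonneg.2 h1), ENNReal.toReal_ofReal h0,
    smul_eq_mul, smul_eq_mul]

lemma measureReal_zeroInflated_expMeasure_Iic {p x : ℝ} (hr : 0 < r) (h0 : 0 ≤ p) (h1 : p ≤ 1)
    (hx : 0 ≤ x) :
    (zeroInflated p (expMeasure r)).real (Set.Iic x) = 1 - p * Real.exp (-(r * x)) := by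
  have := isProbabilityMeasure_expMeasure hr
  have := (Measure.dirac (0 : ℝ)).smul_finite (ENNReal.ofReal_ne_top (r := 1 - p))
  have := (expMeasure r).smul_finite (ENNReal.ofReal_ne_top (r := p))
  rw [zeroInflated, measureReal_add_apply (measure_ne_top _ _) (measure_ne_top _ _),
    measureReal_ennreal_smul_apply, measureReal_ennreal_smul_apply,
    measureReal_expMeasure_Iic hr hx, measureReal_def, Measure.dirac_apply' _ measurableSet_Iic,
    Set.indicator_of_mem (Set.mem_Iic.2 hx), ENNReal.toReal_ofReal (sub_nonneg.2 h1),
    ENNReal.toReal_ofReal h0, Pi.one_apply, ENNReal.toReal_one]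
  ring

lemma zeroInflated_expMeasure_Iic_of_neg {p x : ℝ} (hx : x < 0) :
    zeroInflated p (expMeasure r) (Set.Iic x) = 0 := by
  have hpos : expMeasure r (Set.Iic x) = 0 :=
    measure_mono_null (fun t (ht : t ≤ x) => not_lt.2 (ht.trans hx.le))
      (ae_iff.1 (ae_expMeasure_pos r))
  simp [zeroInflated, hpos, hx]

lemma map_excess_expMeasure {d : ℝ} (hr : 0 < r) (hd : 0 ≤ d) :
    (expMeasure r).map (fun t => max (t - d) 0) =
      zeroInflated (Real.exp (-(r * d))) (expMeasure r) := by
  have := isProbabilityMeasure_expMeasure hr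
  have hexp : Real.exp (-(r * d)) ≤ 1 := exp_neg_mul_le_one hr.le hd
  have := isProbabilityMeasure_zeroInflated (ρ := expMeasure r) (Real.exp_nonneg _) hexp
  have hm : Measurable fun t : ℝ => max (t - d) 0 := by fun_prop
  refine Measure.ext_of_Iic _ _ fun x => ?_
  rw [Measure.map_apply hm measurableSet_Iic]
  rcases lt_or_ge x 0 with hx | hx
  · have hset : (fun t : ℝ => max (t - d) 0) ⁻¹' Set.Iic x = ∅ := by
      ext t
      simp [hx]
    rw [hset, measure_empty, zeroInflated_expMeasure_Iic_of_neg hx]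
  · have hset : (fun t : ℝ => max (t - d) 0) ⁻¹' Set.Iic x = Set.Iic (d + x) := by
      ext t
      simp [hx, add_comm]
    rw [hset, ← measureReal_eq_measureReal_iff, measureReal_expMeasure_Iic hr (add_nonneg hd hx),
      measureReal_zeroInflated_expMeasure_Iic hr (Real.exp_nonneg _) hexp hx, ← Real.exp_add]
    ring_nf

lemma integral_excess_expMeasure {d : ℝ} (hr : 0 < r) (hd : 0 ≤ d) {f : ℝ → ℝ}
    (hf : Measurable f) (hint : Integrable f (expMeasure r)) :
    ∫ t, f (max (t - d) 0) ∂expMeasure r =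
      (1 - Real.exp (-(r * d))) * f 0 + Real.exp (-(r * d)) * ∫ t, f t ∂expMeasure r := by
  rw [← integral_zeroInflated (Real.exp_nonneg _) (exp_neg_mul_le_one hr.le hd) hint,
    ← map_excess_expMeasure hr hd, integral_map (by fun_prop) hf.aestronglyMeasurable]

lemma map_excess_prod_expMeasure {ν : Measure ℝ} [IsProbabilityMeasure ν] (hr : 0 < r)
    (hν : ∀ᵐ y ∂ν, 0 ≤ y) :
    ((expMeasure r).prod ν).map (fun w => max (w.1 - w.2) 0) =
      zeroInflated (∫ y, Real.exp (-(r * y)) ∂ν) (expMeasure r) := by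
  have := isProbabilityMeasure_expMeasure hr
  have hexp : Integrable (fun y => Real.exp (-(r * y))) ν := integrable_exp_neg_mul hr.le hν
  have hsub : Integrable (fun y => 1 - Real.exp (-(r * y))) ν := (integrable_const 1).sub hexp
  have hone_sub : ∫⁻ y, ENNReal.ofReal (1 - Real.exp (-(r * y))) ∂ν
      = ENNReal.ofReal (1 - ∫ y, Real.exp (-(r * y)) ∂ν) := by
    rw [← ofReal_integral_eq_lintegral_ofReal hsub
      (hν.mono fun y hy => sub_nonneg.2 (exp_neg_mul_le_one hr.le hy)),
      integral_sub (integrable_const 1) hexp, integral_const, probReal_univ, one_smul]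
  ext s hs
  calc ((expMeasure r).prod ν).map (fun w => max (w.1 - w.2) 0) s
      = ∫⁻ y, (expMeasure r).map (fun t => max (t - y) 0) s ∂ν := by
        rw [Measure.map_apply (by fun_prop) hs, Measure.prod_apply_symm (by measurability)]
        refine lintegral_congr fun y => ?_
        rw [Measure.map_apply (by fun_prop) hs]
        rfl
    _ = ∫⁻ y, (ENNReal.ofReal (1 - Real.exp (-(r * y))) * Measure.dirac 0 s
          + ENNReal.ofReal (Real.exp (-(r * y))) * expMeasure r s) ∂ν := by
        refine lintegral_congr_ae ?_
        filter_upwards [hν] with y hy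
        rw [map_excess_expMeasure hr hy]
        rfl
    _ = zeroInflated (∫ y, Real.exp (-(r * y)) ∂ν) (expMeasure r) s := by
        rw [lintegral_add_left (by fun_prop), lintegral_mul_const _ (by fun_prop),
          lintegral_mul_const _ (by fun_prop), hone_sub,
          ← ofReal_integral_eq_lintegral_ofReal hexp (ae_of_all _ fun _ => Real.exp_nonneg _)]
        rfl

lemma integrable_excess_prod_expMeasure {ν : Measure ℝ} [IsProbabilityMeasure ν] (hr : 0 < r)
    (hν : ∀ᵐ y ∂ν, 0 ≤ y) {f : ℝ → ℝ} (hint : Integrable f (expMeasure r)) :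
    Integrable (fun w : ℝ × ℝ => f (max (w.1 - w.2) 0)) ((expMeasure r).prod ν) :=
  Integrable.comp_measurable (f := fun w : ℝ × ℝ => max (w.1 - w.2) 0)
    (map_excess_prod_expMeasure hr hν ▸ integrable_zeroInflated hint) (by fun_prop)

lemma integral_excess_prod_expMeasure (hμ : 0 < μ) (hτ : 0 < τ) {f : ℝ → ℝ} (hf : Measurable f)
    (hint : Integrable f (expMeasure μ)) :
    ∫ w : ℝ × ℝ, f (max (w.1 - w.2) 0) ∂(expMeasure μ).prod (expMeasure τ) =
      μ / (μ + τ) * f 0 + τ / (μ + τ) * ∫ t, f t ∂expMeasure μ := by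
  have := isProbabilityMeasure_expMeasure hτ
  have hμτ : μ + τ ≠ 0 := by positivity
  have hp : 1 - τ / (μ + τ) = μ / (μ + τ) := by field_simp; ring
  rw [← hp, ← integral_zeroInflated (by positivity) (by rw [← sub_nonneg, hp]; positivity) hint,
    add_comm μ, ← integral_exp_neg_mul_expMeasure hτ.le (by linarith),
    ← map_excess_prod_expMeasure hμ (ae_expMeasure_nonneg τ),
    integral_map (by fun_prop) hf.aestronglyMeasurable]

end Exponential

section Potential

variable {μ τ : ℝ}

/-- The Lyapunov exponent of the system with rates `μ` and `τ`. -/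
noncomputable def growthRate (μ τ : ℝ) : ℝ :=
  (μ ^ 4 + μ ^ 3 * τ + μ ^ 2 * τ ^ 2 + μ * τ ^ 3 + τ ^ 4) / (μ * τ * (μ + τ) * (μ ^ 2 + τ ^ 2))

lemma growthRate_comm (μ τ : ℝ) : growthRate μ τ = growthRate τ μ := by
  unfold growthRate
  ring_nf

/-- The correction of the maximum when one coordinate leads by `t`. Up to an additive constant,
lack of memory only allows multiples of `exp (-(τ * t))`, the probability that an exponential
variable of rate `τ` exceeds the lead; the coefficient makes the drift of `potential` constant. -/
noncomputable def discount (μ τ t : ℝ) : ℝ :=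
  μ ^ 2 / (τ * (μ ^ 2 + τ ^ 2)) * (1 - Real.exp (-(τ * t)))

lemma measurable_discount (μ τ : ℝ) : Measurable (discount μ τ) := by
  unfold discount
  fun_prop

lemma discount_zero (μ τ : ℝ) : discount μ τ 0 = 0 := by simp [discount]

lemma discount_nonneg {t : ℝ} (hτ : 0 ≤ τ) (ht : 0 ≤ t) : 0 ≤ discount μ τ t :=
  mul_nonneg (by positivity) (sub_nonneg.2 (exp_neg_mul_le_one hτ ht))

lemma discount_le {t : ℝ} (hτ : 0 < τ) : discount μ τ t ≤ 1 / τ := by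
  have hcoeff : μ ^ 2 / (τ * (μ ^ 2 + τ ^ 2)) ≤ 1 / τ := by
    rw [div_le_div_iff₀ (by positivity) hτ]
    nlinarith [pow_pos hτ 3]
  calc discount μ τ t ≤ μ ^ 2 / (τ * (μ ^ 2 + τ ^ 2)) * 1 := by
        unfold discount
        gcongr
        linarith [Real.exp_pos (-(τ * t))]
    _ ≤ 1 / τ := by rwa [mul_one]

/-- The corrected maximum: `max x y` less a bounded function of the difference `x - y`, chosen so
that every step of the system raises its mean by the same amount `growthRate μ τ`. -/
noncomputable def potential (μ τ x y : ℝ) : ℝ :=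
  max x y - discount μ τ (max (x - y) 0) - discount τ μ (max (y - x) 0)

lemma measurable_potential (μ τ : ℝ) : Measurable fun w : ℝ × ℝ => potential μ τ w.1 w.2 := by
  have h₁ := measurable_discount μ τ
  have h₂ := measurable_discount τ μ
  unfold potential
  fun_prop

lemma potential_swap (μ τ x y : ℝ) : potential τ μ y x = potential μ τ x y := by
  unfold potential
  rw [max_comm y x]
  ring

lemma potential_of_le {x y : ℝ} (h : y ≤ x) : potential μ τ x y = x - discount μ τ (x - y) := by
  rw [potential, max_eq_left h, max_eq_left (sub_nonneg.2 h), max_eq_right (sub_nonpos.2 h),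
    discount_zero, sub_zero]

lemma potential_add_add (μ τ c u v : ℝ) :
    potential μ τ (c + u) (c + v) = c + potential μ τ u v := by
  unfold potential
  rw [max_add_add_left, add_sub_add_left_eq_sub, add_sub_add_left_eq_sub]
  ring

lemma potential_eq_min_add (μ τ x y : ℝ) :
    potential μ τ x y = min x y + (max (x - y) 0 - discount μ τ (max (x - y) 0)) +
      (max (y - x) 0 - discount τ μ (max (y - x) 0)) := by
  have h : max x y = min x y + max (x - y) 0 + max (y - x) 0 := by grind
  unfold potential
  rw [h]
  ring

lemma abs_potential_sub_max_le (hμ : 0 < μ) (hτ : 0 < τ) (x y : ℝ) :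
    |potential μ τ x y - max x y| ≤ 1 / τ + 1 / μ := by
  have h₁ := discount_nonneg (μ := μ) hτ.le (le_max_right (x - y) 0)
  have h₂ := discount_nonneg (μ := τ) hμ.le (le_max_right (y - x) 0)
  have h₃ := discount_le (μ := μ) (t := max (x - y) 0) hτ
  have h₄ := discount_le (μ := τ) (t := max (y - x) 0) hμ
  unfold potential
  rw [abs_le]
  constructor <;> linarith

lemma abs_potential_le (hμ : 0 < μ) (hτ : 0 < τ) (x y : ℝ) :
    |potential μ τ x y| ≤ |x| + |y| + (1 / τ + 1 / μ) := by
  have hmax : |max x y| ≤ |x| + |y| :=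
    abs_max_le_max_abs_abs.trans (max_le_add_of_nonneg (abs_nonneg x) (abs_nonneg y))
  linarith [abs_sub_abs_le_abs_sub (potential μ τ x y) (max x y),
    abs_potential_sub_max_le hμ hτ x y]

end Potential

section Drift

variable {μ τ : ℝ}

lemma integrable_discount_expMeasure (hμ : 0 < μ) (hτ : 0 < τ) :
    Integrable (discount μ τ) (expMeasure μ) := by
  have := isProbabilityMeasure_expMeasure hμ
  refine (integrable_const (1 / τ)).mono' (measurable_discount μ τ).aestronglyMeasurable ?_
  filter_upwards [ae_expMeasure_pos μ] with t ht
  rw [Real.norm_of_nonneg (discount_nonneg hτ.le ht.le)]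
  exact discount_le hτ

lemma integral_discount_expMeasure (hμ : 0 < μ) (hτ : 0 < τ) :
    ∫ t, discount μ τ t ∂expMeasure μ = μ ^ 2 / ((μ + τ) * (μ ^ 2 + τ ^ 2)) := by
  have := isProbabilityMeasure_expMeasure hμ
  simp only [discount]
  rw [integral_const_mul, integral_sub (integrable_const 1)
    (integrable_exp_neg_mul hτ.le (ae_expMeasure_nonneg μ)),
    integral_exp_neg_mul_expMeasure hμ.le (add_pos hμ hτ), integral_const, probReal_univ, one_smul]
  field_simp
  ring

lemma integrable_sub_discount_expMeasure (hμ : 0 < μ) (hτ : 0 < τ) :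
    Integrable (fun t => t - discount μ τ t) (expMeasure μ) := by
  have := isProbabilityMeasure_expMeasure hμ
  exact ((memLp_two_id_expMeasure hμ).integrable one_le_two).sub
    (integrable_discount_expMeasure hμ hτ)

lemma integral_sub_discount_expMeasure (hμ : 0 < μ) (hτ : 0 < τ) :
    ∫ t, (t - discount μ τ t) ∂expMeasure μ =
      growthRate μ τ - μ ^ 2 / (τ * (μ ^ 2 + τ ^ 2)) := by
  have := isProbabilityMeasure_expMeasure hμ
  rw [integral_sub ((memLp_two_id_expMeasure hμ).integrable one_le_two)
    (integrable_discount_expMeasure hμ hτ), integral_id_expMeasure hμ,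
    integral_discount_expMeasure hμ hτ, growthRate]
  field_simp
  ring

lemma memLp_prod_of_abs_le_add {p : ENNReal} {ρ σ : Measure ℝ} [IsFiniteMeasure ρ]
    [IsFiniteMeasure σ] (hρ : MemLp (fun t : ℝ => t) p ρ) (hσ : MemLp (fun t : ℝ => t) p σ)
    {F : ℝ × ℝ → ℝ} (hF : Measurable F) {K : ℝ} (hK : ∀ w, |F w| ≤ |w.1| + |w.2| + K) :
    MemLp F p (ρ.prod σ) :=
  ((hρ.comp_fst σ).abs.add (hσ.comp_snd ρ).abs |>.add (memLp_const K)).mono'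
    hF.aestronglyMeasurable (ae_of_all _ hK)

lemma integrable_prod_expMeasure_of_abs_le (hμ : 0 < μ) (hτ : 0 < τ) {F : ℝ × ℝ → ℝ}
    (hF : Measurable F) {K : ℝ} (hK : ∀ w, |F w| ≤ |w.1| + |w.2| + K) :
    Integrable F ((expMeasure μ).prod (expMeasure τ)) := by
  have := isProbabilityMeasure_expMeasure hμ
  have := isProbabilityMeasure_expMeasure hτ
  exact (memLp_prod_of_abs_le_add (memLp_two_id_expMeasure hμ) (memLp_two_id_expMeasure hτ)
    hF hK).integrable one_le_two

lemma integrable_potential (hμ : 0 < μ) (hτ : 0 < τ) :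
    Integrable (fun w : ℝ × ℝ => potential μ τ w.1 w.2) ((expMeasure μ).prod (expMeasure τ)) :=
  integrable_prod_expMeasure_of_abs_le hμ hτ (measurable_potential μ τ) fun w =>
    abs_potential_le hμ hτ w.1 w.2

lemma integral_min_prod_expMeasure (hμ : 0 < μ) (hτ : 0 < τ) :
    ∫ w : ℝ × ℝ, min w.1 w.2 ∂(expMeasure μ).prod (expMeasure τ) = 1 / (μ + τ) := by
  have := isProbabilityMeasure_expMeasure hμ
  have := isProbabilityMeasure_expMeasure hτ
  have hid : Integrable (fun t : ℝ => t) (expMeasure μ) :=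
    (memLp_two_id_expMeasure hμ).integrable one_le_two
  calc ∫ w : ℝ × ℝ, min w.1 w.2 ∂(expMeasure μ).prod (expMeasure τ)
      = ∫ w : ℝ × ℝ, (w.1 - max (w.1 - w.2) 0) ∂(expMeasure μ).prod (expMeasure τ) := by
        congr with w
        grind
    _ = 1 / μ - τ / (μ + τ) * (1 / μ) := by
        rw [integral_sub (hid.comp_fst _) (integrable_excess_prod_expMeasure hμ
          (ae_expMeasure_nonneg τ) hid),
          integral_excess_prod_expMeasure (f := fun t => t) hμ hτ measurable_id hid,
          integral_fun_fst (fun t => t), probReal_univ, one_smul, integral_id_expMeasure hμ,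
          mul_zero, zero_add]
    _ = 1 / (μ + τ) := by
        field_simp
        ring

lemma integral_excess_sub_discount (hμ : 0 < μ) (hτ : 0 < τ) :
    ∫ w : ℝ × ℝ, (max (w.1 - w.2) 0 - discount μ τ (max (w.1 - w.2) 0))
        ∂(expMeasure μ).prod (expMeasure τ) =
      τ / (μ + τ) * (growthRate μ τ - μ ^ 2 / (τ * (μ ^ 2 + τ ^ 2))) := by
  rw [integral_excess_prod_expMeasure (f := fun t => t - discount μ τ t) hμ hτ
    (measurable_id.sub (measurable_discount μ τ)) (integrable_sub_discount_expMeasure hμ hτ),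
    integral_sub_discount_expMeasure hμ hτ, discount_zero, sub_zero, mul_zero, zero_add]

lemma integral_potential (hμ : 0 < μ) (hτ : 0 < τ) :
    ∫ w : ℝ × ℝ, potential μ τ w.1 w.2 ∂(expMeasure μ).prod (expMeasure τ) = growthRate μ τ := by
  have := isProbabilityMeasure_expMeasure hμ
  have := isProbabilityMeasure_expMeasure hτ
  have hfst : Integrable (fun w : ℝ × ℝ => max (w.1 - w.2) 0 - discount μ τ (max (w.1 - w.2) 0))
      ((expMeasure μ).prod (expMeasure τ)) :=
    integrable_excess_prod_expMeasure hμ (ae_expMeasure_nonneg τ)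
      (integrable_sub_discount_expMeasure hμ hτ)
  have hsnd : Integrable (fun w : ℝ × ℝ => max (w.2 - w.1) 0 - discount τ μ (max (w.2 - w.1) 0))
      ((expMeasure μ).prod (expMeasure τ)) :=
    (integrable_excess_prod_expMeasure hτ (ae_expMeasure_nonneg μ)
      (integrable_sub_discount_expMeasure hτ hμ)).swap
  have hmin : Integrable (fun w : ℝ × ℝ => min w.1 w.2) ((expMeasure μ).prod (expMeasure τ)) :=
    integrable_prod_expMeasure_of_abs_le (K := 0) hμ hτ (by fun_prop) fun w => by
      rw [add_zero]
      exact abs_min_le_max_abs_abs.trans (max_le_add_of_nonneg (abs_nonneg _) (abs_nonneg _))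
  have hsnd_eq : ∫ w : ℝ × ℝ, (max (w.2 - w.1) 0 - discount τ μ (max (w.2 - w.1) 0))
      ∂(expMeasure μ).prod (expMeasure τ) =
      μ / (τ + μ) * (growthRate τ μ - τ ^ 2 / (μ * (τ ^ 2 + μ ^ 2))) := by
    rw [← integral_excess_sub_discount hτ hμ, ← integral_prod_swap]
    rfl
  simp_rw [potential_eq_min_add]
  rw [integral_add (hmin.fun_add hfst) hsnd, integral_add hmin hfst, hsnd_eq,
    integral_excess_sub_discount hμ hτ, integral_min_prod_expMeasure hμ hτ, growthRate, growthRate]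
  field_simp
  ring

lemma potential_zero_right_ae_eq (μ τ : ℝ) :
    (fun a => potential μ τ a 0) =ᵐ[expMeasure μ] fun a => a - discount μ τ a := by
  filter_upwards [ae_expMeasure_pos μ] with a ha
  rw [potential_of_le ha.le, sub_zero]

lemma integrable_potential_excess (hμ : 0 < μ) (hτ : 0 < τ) (d : ℝ) :
    Integrable (fun w : ℝ × ℝ => potential μ τ w.1 (max (w.2 - d) 0))
      ((expMeasure μ).prod (expMeasure τ)) := by
  refine integrable_prod_expMeasure_of_abs_le (K := |d| + (1 / τ + 1 / μ)) hμ hτ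
    ((measurable_potential μ τ).comp (f := fun w : ℝ × ℝ => (w.1, max (w.2 - d) 0))
      (by fun_prop)) fun w => ?_
  have hexcess : |max (w.2 - d) 0| ≤ |w.2| + |d| :=
    abs_max_le_max_abs_abs.trans (by
      rw [abs_zero]
      exact max_le (abs_sub w.2 d) (by positivity))
  linarith [abs_potential_le hμ hτ w.1 (max (w.2 - d) 0)]

lemma integral_potential_excess {d : ℝ} (hμ : 0 < μ) (hτ : 0 < τ) (hd : 0 ≤ d) :
    ∫ w : ℝ × ℝ, potential μ τ w.1 (max (w.2 - d) 0) ∂(expMeasure μ).prod (expMeasure τ) =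
      growthRate μ τ - discount μ τ d := by
  have := isProbabilityMeasure_expMeasure hμ
  have := isProbabilityMeasure_expMeasure hτ
  have hint := integrable_potential hμ hτ
  have hzero := potential_zero_right_ae_eq μ τ
  have hint_zero : Integrable (fun a => potential μ τ a 0) (expMeasure μ) :=
    (integrable_sub_discount_expMeasure hμ hτ).congr hzero.symm
  calc ∫ w : ℝ × ℝ, potential μ τ w.1 (max (w.2 - d) 0) ∂(expMeasure μ).prod (expMeasure τ)
      = ∫ a, ((1 - Real.exp (-(τ * d))) * potential μ τ a 0 + Real.exp (-(τ * d)) *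
          ∫ t, potential μ τ a t ∂expMeasure τ) ∂expMeasure μ := by
        rw [integral_prod _ (integrable_potential_excess hμ hτ d)]
        refine integral_congr_ae ?_
        filter_upwards [hint.prod_right_ae] with a ha
        exact integral_excess_expMeasure hτ hd
          ((measurable_potential μ τ).comp measurable_prodMk_left) ha
    _ = (1 - Real.exp (-(τ * d))) * (growthRate μ τ - μ ^ 2 / (τ * (μ ^ 2 + τ ^ 2))) +
          Real.exp (-(τ * d)) * growthRate μ τ := by
        rw [integral_add (hint_zero.const_mul _) (hint.integral_prod_left.const_mul _),
          integral_const_mul, integral_const_mul, integral_congr_ae hzero,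
          integral_sub_discount_expMeasure hμ hτ, ← integral_prod _ hint, integral_potential hμ hτ]
    _ = growthRate μ τ - discount μ τ d := by
        unfold discount
        ring

lemma ae_prod_expMeasure_pos (μ τ : ℝ) :
    ∀ᵐ w ∂(expMeasure μ).prod (expMeasure τ), 0 < w.1 ∧ 0 < w.2 :=
  (Measure.quasiMeasurePreserving_fst.ae (ae_expMeasure_pos μ)).and
    (Measure.quasiMeasurePreserving_snd.ae (ae_expMeasure_pos τ))

lemma integral_potential_step_sub_of_le {x y : ℝ} (hμ : 0 < μ) (hτ : 0 < τ) (hyx : y ≤ x) :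
    ∫ w : ℝ × ℝ, (potential μ τ (max (x + w.1) y) (max x (y + w.2)) - potential μ τ x y)
      ∂(expMeasure μ).prod (expMeasure τ) = growthRate μ τ := by
  have := isProbabilityMeasure_expMeasure hμ
  have := isProbabilityMeasure_expMeasure hτ
  have hstep : (fun w : ℝ × ℝ =>
        potential μ τ (max (x + w.1) y) (max x (y + w.2)) - potential μ τ x y)
      =ᵐ[(expMeasure μ).prod (expMeasure τ)]
      fun w => potential μ τ w.1 (max (w.2 - (x - y)) 0) + discount μ τ (x - y) := by
    filter_upwards [ae_prod_expMeasure_pos μ τ] with w hw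
    have hfst : max (x + w.1) y = x + w.1 := max_eq_left (by linarith [hw.1])
    have hsnd : max x (y + w.2) = x + max (w.2 - (x - y)) 0 := by grind
    rw [hfst, hsnd, potential_add_add, potential_of_le hyx]
    ring
  rw [integral_congr_ae hstep, integral_add (integrable_potential_excess hμ hτ _)
    (integrable_const _), integral_potential_excess hμ hτ (sub_nonneg.2 hyx), integral_const,
    probReal_univ, one_smul, sub_add_cancel]

lemma integral_potential_step_sub (hμ : 0 < μ) (hτ : 0 < τ) (x y : ℝ) :
    ∫ w : ℝ × ℝ, (potential μ τ (max (x + w.1) y) (max x (y + w.2)) - potential μ τ x y)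
      ∂(expMeasure μ).prod (expMeasure τ) = growthRate μ τ := by
  have := isProbabilityMeasure_expMeasure hμ
  have := isProbabilityMeasure_expMeasure hτ
  rcases le_total y x with hyx | hxy
  · exact integral_potential_step_sub_of_le hμ hτ hyx
  · rw [growthRate_comm, ← integral_potential_step_sub_of_le hτ hμ hxy, ← integral_prod_swap]
    congr with w
    rw [← potential_swap, ← potential_swap τ μ y x, max_comm y, max_comm _ x]
    rfl

end Drift

section System

variable {μ τ : ℝ}

/-- One step of the system, the diagonal noise of the transition matrix being given as a pair. -/
def diagStep (z : Fin 2 → ℝ) (w : ℝ × ℝ) : Fin 2 → ℝ :=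
  mulVec !![w.1, 0; 0, w.2] z

lemma diagStep_zero (z : Fin 2 → ℝ) (w : ℝ × ℝ) : diagStep z w 0 = max (z 0 + w.1) (z 1) := by
  simp [diagStep, mulVec]

lemma diagStep_one (z : Fin 2 → ℝ) (w : ℝ × ℝ) : diagStep z w 1 = max (z 0) (z 1 + w.2) := by
  simp [diagStep, mulVec]

lemma state_eq_orbit (a d : ℕ → ℝ) (n : ℕ) :
    state (fun k => !![a k, 0; 0, d k]) n =
      orbit diagStep (fun _ => 0) (fun k => (a k, d k)) n := by
  induction n with
  | zero => rfl
  | succ n ih => rw [state, ih, orbit, diagStep]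

lemma measurable_diagStep : Measurable fun p : (Fin 2 → ℝ) × (ℝ × ℝ) => diagStep p.1 p.2 := by
  refine measurable_pi_lambda _ fun i => ?_
  fin_cases i
  · simp only [Fin.zero_eta, diagStep_zero]
    fun_prop
  · simp only [Fin.mk_one, diagStep_one]
    fun_prop

lemma le_max_diagStep {z : Fin 2 → ℝ} {w : ℝ × ℝ} (h₁ : 0 ≤ w.1) (h₂ : 0 ≤ w.2) :
    max (z 0) (z 1) ≤ max (diagStep z w 0) (diagStep z w 1) := by
  rw [diagStep_zero, diagStep_one]
  grind

lemma abs_max_diagStep_sub_max_le (z : Fin 2 → ℝ) (w : ℝ × ℝ) :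
    |max (diagStep z w 0) (diagStep z w 1) - max (z 0) (z 1)| ≤ |w.1| + |w.2| := by
  rw [diagStep_zero, diagStep_one]
  grind

lemma abs_potential_diagStep_sub_le (hμ : 0 < μ) (hτ : 0 < τ) (z : Fin 2 → ℝ) (w : ℝ × ℝ) :
    |potential μ τ (diagStep z w 0) (diagStep z w 1) - potential μ τ (z 0) (z 1)| ≤
      |w.1| + |w.2| + 2 * (1 / τ + 1 / μ) := by
  have h₁ := abs_le.1 (abs_potential_sub_max_le hμ hτ (diagStep z w 0) (diagStep z w 1))
  have h₂ := abs_le.1 (abs_potential_sub_max_le hμ hτ (z 0) (z 1))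
  have h₃ := abs_le.1 (abs_max_diagStep_sub_max_le z w)
  rw [abs_le]
  constructor <;> linarith

lemma integral_potential_diagStep_sub (hμ : 0 < μ) (hτ : 0 < τ) (z : Fin 2 → ℝ) :
    ∫ w, (potential μ τ (diagStep z w 0) (diagStep z w 1) - potential μ τ (z 0) (z 1))
      ∂(expMeasure μ).prod (expMeasure τ) = growthRate μ τ := by
  simp only [diagStep_zero, diagStep_one]
  exact integral_potential_step_sub hμ hτ (z 0) (z 1)

lemma monotone_max_orbit_diagStep (z : Fin 2 → ℝ) {w : ℕ → ℝ × ℝ}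
    (hw : ∀ n, 0 ≤ (w n).1 ∧ 0 ≤ (w n).2) :
    Monotone fun n => max (orbit diagStep z w n 0) (orbit diagStep z w n 1) :=
  monotone_nat_of_le_succ fun n => le_max_diagStep (hw n).1 (hw n).2

end System

section Independence

variable {Ω F : Type*} [MeasurableSpace Ω] [MeasurableSpace F] {P : Measure Ω}

lemma indepFun_past_pair {α δ : ℕ → Ω → F} (hα : ∀ n, AEMeasurable (α n) P)
    (hδ : ∀ n, AEMeasurable (δ n) P)
    (hindep : iIndepFun (fun i : ℕ ⊕ ℕ => Sum.elim α δ i) P) (n : ℕ) :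
    IndepFun (fun ω (k : Fin n) => (α k ω, δ k ω)) (fun ω => (α n ω, δ n ω)) P := by
  let S := (Finset.range n).disjSum (Finset.range n)
  let T : Finset (ℕ ⊕ ℕ) := {.inl n, .inr n}
  have hST : Disjoint S T := by simp [S, T]
  have hmeas : ∀ i, AEMeasurable (Sum.elim α δ i) P := Sum.rec hα hδ
  refine (hindep.indepFun_finset₀ S T hST hmeas).comp
    (φ := fun t (k : Fin n) => (t ⟨.inl k, by simp [S]⟩, t ⟨.inr k, by simp [S]⟩))
    (ψ := fun t => (t ⟨.inl n, by simp [T]⟩, t ⟨.inr n, by simp [T]⟩)) ?_ ?_ <;> fun_prop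

end Independence

lemma isLyapunovExponent_growthRate {Ω : Type*} [MeasurableSpace Ω] {P : Measure Ω}
    [IsProbabilityMeasure P] {μ τ : ℝ} (hμ : 0 < μ) (hτ : 0 < τ) {α δ : ℕ → Ω → ℝ}
    (hα : ∀ k, HasLaw (α k) (expMeasure μ) P) (hδ : ∀ k, HasLaw (δ k) (expMeasure τ) P)
    (hindep : iIndepFun (fun i : ℕ ⊕ ℕ => Sum.elim α δ i) P) :
    IsLyapunovExponent P (fun k ω => !![α k ω, 0; 0, δ k ω]) (growthRate μ τ) := by
  have := isProbabilityMeasure_expMeasure hμ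
  have := isProbabilityMeasure_expMeasure hτ
  have hlaw : ∀ n, HasLaw (fun ω => (α n ω, δ n ω)) ((expMeasure μ).prod (expMeasure τ)) P :=
    fun n => IndepFun.hasLaw_prod (hα n) (hδ n) (hindep.indepFun Sum.inl_ne_inr)
  have hpos : ∀ᵐ ω ∂P, ∀ n, 0 < α n ω ∧ 0 < δ n ω := ae_all_iff.2 fun n =>
    (hlaw n).ae_iff (p := fun w => 0 < w.1 ∧ 0 < w.2) (by measurability) |>.2
      (ae_prod_expMeasure_pos μ τ)
  have hb : MemLp (fun w : ℝ × ℝ => |w.1| + |w.2| + 2 * (1 / τ + 1 / μ)) 2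
      ((expMeasure μ).prod (expMeasure τ)) :=
    memLp_prod_of_abs_le_add (K := 2 * (1 / τ + 1 / μ)) (memLp_two_id_expMeasure hμ)
      (memLp_two_id_expMeasure hτ) (by fun_prop) fun w => (abs_of_nonneg (by positivity)).le
  have hlim := ae_tendsto_div_of_drift (z₀ := fun _ => 0) measurable_diagStep hlaw
    (indepFun_past_pair (fun n => (hα n).aemeasurable) (fun n => (hδ n).aemeasurable) hindep)
    (h := fun z => potential μ τ (z 0) (z 1))
    ((measurable_potential μ τ).comp (f := fun z : Fin 2 → ℝ => (z 0, z 1)) (by fun_prop)) hb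
    (abs_potential_diagStep_sub_le hμ hτ) (integral_potential_diagStep_sub hμ hτ)
    (u := fun z => max (z 0) (z 1)) (fun z => abs_potential_sub_max_le hμ hτ (z 0) (z 1))
    (hpos.mono fun ω hω => monotone_max_orbit_diagStep _ fun n => ⟨(hω n).1.le, (hω n).2.le⟩)
  filter_upwards [hlim] with ω hω
  simpa only [state_eq_orbit, one_div_mul_eq_div] using hω

end MaxPlus

theorem mainTheorem3 {Ω : Type*} [MeasurableSpace Ω] (P : Measure Ω) [IsProbabilityMeasure P]
    (μ τ : ℝ) (hμ : 0 < μ) (hτ : 0 < τ) (α δ : ℕ → Ω → ℝ)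
    (hα : ∀ k, HasLaw (α k) (expMeasure μ) P)
    (hδ : ∀ k, HasLaw (δ k) (expMeasure τ) P)
    (hindep : iIndepFun (fun i : ℕ ⊕ ℕ => Sum.elim α δ i) P) :
    MaxPlus.IsLyapunovExponent P (fun k ω => !![α k ω, 0; 0, δ k ω])
      ((μ ^ 4 + μ ^ 3 * τ + μ ^ 2 * τ ^ 2 + μ * τ ^ 3 + τ ^ 4) /
        (μ * τ * (μ + τ) * (μ ^ 2 + τ ^ 2))) ∧
    (μ = 1 → τ = 1 →
      MaxPlus.IsLyapunovExponent P (fun k ω => !![α k ω, 0; 0, δ k ω]) 1.25) := by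
  have hmain := MaxPlus.isLyapunovExponent_growthRate hμ hτ hα hδ hindep
  refine ⟨hmain, ?_⟩
  rintro rfl rfl
  convert hmain using 1
  norm_num [MaxPlus.growthRate]
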